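/- Consider the following forest fire model on $\mathbb{Z}_+=\{0,1,2,\dots\}$ with instantaneous burning ($\theta\equiv 0$) and spreading delays distributed as a non-negative random variable $\Delta$. Initially all sites are vacant. At each vacant site a tree appears after an $\exp(1)$-distributed waiting time (counted from time $0$ or from the last burning of the site). A tree that appears at site $0$ burns immediately; this starts a new fire, and the fires are numbered in the order in which they start. When site $x$ burns for the $i$-th time, at time $f_{x,i}$, it becomes vacant at once, and the fire that burnt it comes to affect site $x+1$ at time $f_{x,i}+\Delta_{x,i}$: if at that time site $x+1$ is occupied by a tree, and if all the earlier fires that burnt $x$ have affected $x+1$ strictly before that time (so that fires do not overtake each other), then the tree at $x+1$ burns at time $f_{x,i}+\Delta_{x,i}$ and the fire goes on from there; otherwise the fire stops at $x$. The $\Delta_{x,i}$ are distributed as $\Delta$, and all the waiting times and all the $\Delta_{x,i}$ are independent. Let $n_k\in\{0,1,2,\dots\}\cup\{\infty\}$ be the right-most point burnt by the $k$-th fire, and let $\zeta_k\in[0,\infty]$ be its duration, that is, the sum of the delays which lead it from $0$ to $n_k$. The $k$-th fire is called infinite if $n_k=\infty$ and $\zeta_k=\infty$. **Theorem.** Suppose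 that $\Delta\ge 0$, $0<\mathbb{E}\Delta<\infty$ and $\mathrm{Var}(\Delta)\in(0,\infty]$. Then almost surely there is exactly one infinite fire. Moreover, almost surely there is exactly one $k$ with $n_k=\infty$. -/

import Mathlib

open MeasureTheory ProbabilityTheory

/-!
The forest fire model on `ℕ = {0, 1, 2, …}` with instantaneous burning (burning time zero).

The randomness consists of two arrays of real numbers:
* `w x i` : the waiting time for a new tree at site `x`, counted from time `0` (for `i = 0`) or
  from the `i`-th burning of `x` (for `i ≥ 1`);
* `d x i` : the spreading delay from `x` to `x + 1` of the fire which burns `x` for the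
  `(i + 1)`-st time.
Fires are numbered `0, 1, 2, …` in the order in which they start at the origin.  As nothing that
happens at a site depends on the sites to the right of it, the process is built site by site.
-/

namespace ForestFire

/-- The situation at a site after the first `k` fires have been taken into account. -/
structure SiteState where
  /-- how many of these fires burnt the site -/
  burns : ℕ
  /-- the time at which a tree appears next, the site being vacant from its last burning
  (or from time `0`) until then -/
  planted : ℝ
  /-- the latest time at which one of these fires affects the site; later fires can ignite the
  site only after this time -/
  front : ℝ

/-- The site with state `s` is ignited at time `t`: all the earlier fires have ceased to affect it,
and it is occupied by a tree just before time `t`. -/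
def SiteState.Ignites (s : SiteState) (t : ℝ) : Prop :=
  s.front < t ∧ s.planted < t

open Classical in
/-- The new state after the next fire, which comes to affect the site at time `t` if `a = some t`
and never if `a = none`. A burnt site becomes vacant at once and waits for its next tree. -/
noncomputable def SiteState.next (w : ℕ → ℝ) (s : SiteState) (a : Option ℝ) : SiteState :=
  match a with
  | none => s
  | some t =>
      if s.Ignites t then ⟨s.burns + 1, t + w (s.burns + 1), t⟩
      else ⟨s.burns, s.planted, max s.front t⟩

/-- The state of a site with waiting times `w`, which the fires `0, 1, 2, …` come to affect at
the times `a 0, a 1, a 2, …`, after the first `k` fires. All sites are vacant at time `0`. -/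
noncomputable def siteState (w : ℕ → ℝ) (a : ℕ → Option ℝ) : ℕ → SiteState
  | 0 => ⟨0, w 0, 0⟩
  | k + 1 => (siteState w a k).next w (a k)

open Classical in
/-- The time at which fire `k` burns such a site, and `none` if it does not. -/
noncomputable def burnTime (w : ℕ → ℝ) (a : ℕ → Option ℝ) (k : ℕ) : Option ℝ :=
  (a k).filter fun t => decide ((siteState w a k).Ignites t)

/-- The number of fires among `0, …, k - 1` which burn a site with burning times `f`. If fire `k`
burns the site, then this is its `(burnsBefore f k + 1)`-st burning. -/
def burnsBefore (f : ℕ → Option ℝ) (k : ℕ) : ℕ :=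
  ((Finset.range k).filter fun j => (f j).isSome).card

/-- The times at which the fires come to affect the right neighbour of a site with burning
times `f` and spreading delays `d`. -/
noncomputable def spreadTime (d : ℕ → ℝ) (f : ℕ → Option ℝ) (k : ℕ) : Option ℝ :=
  (f k).map fun t => t + d (burnsBefore f k)

/-- `fireTime w d x k` is the time at which fire `k` burns site `x`, and `none` if it does not.
At the origin every tree starts burning as soon as it appears. -/
noncomputable def fireTime (w d : ℕ → ℕ → ℝ) : ℕ → ℕ → Option ℝ
  | 0 => fun k => some (∑ j ∈ Finset.range (k + 1), w 0 j)
  | x + 1 => burnTime (w (x + 1)) (spreadTime (d x) (fireTime w d x))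

/-- Fire `k` burns site `x`. -/
def Reaches (w d : ℕ → ℕ → ℝ) (k x : ℕ) : Prop :=
  (fireTime w d x k).isSome

/-- The right-most point burnt by fire `k` (`⊤` if there is none). -/
noncomputable def rightmost (w d : ℕ → ℕ → ℝ) (k : ℕ) : ℕ∞ :=
  ⨆ x : {x : ℕ // Reaches w d k x}, ((x : ℕ) : ℕ∞)

open Classical in
/-- The duration of fire `k`: the sum of the spreading delays which lead it from the origin to its
right-most point. -/
noncomputable def duration (w d : ℕ → ℕ → ℝ) (k : ℕ) : ENNReal :=
  ∑' x : ℕ, if Reaches w d k (x + 1) then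
    ENNReal.ofReal (d x (burnsBefore (fireTime w d x) k)) else 0

/-- Fire `k` is an infinite fire. -/
def IsInfiniteFire (w d : ℕ → ℕ → ℝ) (k : ℕ) : Prop :=
  rightmost w d k = ⊤ ∧ duration w d k = ⊤

end ForestFire

/-!
Almost surely the model is typical in the sense of `ForestFire.IsTypical`, and the rest of the
argument is deterministic.

*Existence.* As fires do not overtake each other, no fire burns the site `x` before the sum of the
delays of the first burnings of the sites to the left of `x`
(`ForestFire.IsTypical.sum_delay_le_fireTime`). By the law of large numbers this sum grows linearly
in `x`, while by Borel-Cantelli only finitely many of the first trees take so long to appear.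
Hence, from some site `n` on, the first fire which burns a site always burns the next one, too. As
every site is burnt (`ForestFire.IsTypical.fireTime_frequently_and_tendsto`), the first fire which
burns `n` has no right-most point (`ForestFire.IsTypical.exists_forall_reaches`).

*Uniqueness.* The fires which burn `x + 1` are among those which burn `x`, so that the number of
earlier fires burning `x` along with a given fire does not increase with `x`, and is eventually
constant. If two fires burnt all sites, then the delay between them would thus eventually have the
increments `d x j - d x i` for fixed `i ≠ j`. These are the steps of a nondegenerate symmetric
random walk, which is not bounded below (`ProbabilityTheory.iIndepFun.ae_not_bddBelow_sum`), while
the delay has to stay positive (`ForestFire.IsTypical.not_forall_reaches_of_lt`).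

*Duration.* By the same remark, the delays of a fire which burns all sites are eventually `d x i`
for a fixed `i`, and their sum diverges (`ForestFire.IsTypical.duration_eq_top`).
-/

namespace ForestFire

open Filter Finset

/-! ### The state of a single site -/

section Site

variable {w : ℕ → ℝ} {a : ℕ → Option ℝ} {k l : ℕ} {t : ℝ}

lemma burnTime_eq_some_iff :
    burnTime w a k = some t ↔ a k = some t ∧ (siteState w a k).Ignites t := by
  simp [burnTime, Option.filter_eq_some_iff]

lemma siteState_succ_of_none (h : a k = none) : siteState w a (k + 1) = siteState w a k := by
  simp [siteState, SiteState.next, h]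

lemma siteState_eq_zero (h : ∀ j < k, a j = none) : siteState w a k = ⟨0, w 0, 0⟩ := by
  induction k with
  | zero => rfl
  | succ k ih =>
    rw [siteState_succ_of_none (h k k.lt_succ_self), ih fun j hj => h j (by omega)]

lemma front_succ_eq_max (h : a k = some t) :
    (siteState w a (k + 1)).front = max (siteState w a k).front t := by
  by_cases hi : (siteState w a k).Ignites t
  · simp [siteState, SiteState.next, h, hi, max_eq_right hi.1.le]
  · simp [siteState, SiteState.next, h, hi]

lemma monotone_front : Monotone fun k => (siteState w a k).front := by
  refine monotone_nat_of_le_succ fun k => ?_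
  cases h : a k with
  | none => rw [siteState_succ_of_none h]
  | some t => rw [front_succ_eq_max h]; exact le_max_left _ _

lemma le_front_of_lt (hkl : k < l) (h : a k = some t) : t ≤ (siteState w a l).front := by
  refine le_trans ?_ (monotone_front (Nat.succ_le_of_lt hkl))
  simp only [Nat.succ_eq_add_one, front_succ_eq_max h]
  exact le_max_right _ _

/-- Fires do not overtake each other: a fire burns a site only after all earlier fires have come
to affect it. -/
lemma lt_of_burnTime {s : ℝ} (hkl : k < l) (hk : a k = some s) (hl : burnTime w a l = some t) :
    s < t :=
  (le_front_of_lt hkl hk).trans_lt (burnTime_eq_some_iff.1 hl).2.1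

/-- If fires come to affect a site at arbitrarily late times, then some fire after the first `n`
burns it: otherwise its next tree would be planted at a fixed time, and the first fire coming later
than this time and the current front would ignite the site. -/
lemma exists_burnTime_ne_none (h : ∀ M : ℝ, ∃ᶠ k in atTop, ∃ t ∈ a k, M < t) (n : ℕ) :
    ∃ k ≥ n, (burnTime w a k).isSome := by
  classical
  set M := max (siteState w a n).planted (siteState w a n).front with hM
  have hex : ∃ k, n ≤ k ∧ ∃ t ∈ a k, M < t := frequently_atTop.1 (h M) n
  obtain ⟨hnk, t, ht, hMt⟩ := Nat.find_spec hex
  by_contra! hno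
  -- Up to the first fire `≥ n` which comes later than `M`, neither the planting time nor the front
  -- exceeds `M`.
  have hstate : ∀ j, n + j ≤ Nat.find hex → (siteState w a (n + j)).planted ≤ M ∧
      (siteState w a (n + j)).front ≤ M := by
    intro j
    induction j with
    | zero => intro _; exact ⟨le_max_left _ _, le_max_right _ _⟩
    | succ j ih =>
      intro hj
      obtain ⟨h1, h2⟩ := ih (by omega)
      cases hs : a (n + j) with
      | none => rw [← add_assoc, siteState_succ_of_none hs]; exact ⟨h1, h2⟩
      | some s =>
        have hsM : s ≤ M := by
          have := Nat.find_min hex (m := n + j) (by omega)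
          push Not at this
          exact this (by omega) s hs
        have hi : ¬ (siteState w a (n + j)).Ignites s := fun hi => by
          have := hno (n + j) (by omega)
          rw [burnTime_eq_some_iff.2 ⟨hs, hi⟩] at this
          simp at this
        rw [← add_assoc]
        simp only [siteState, SiteState.next, hs, hi, if_false]
        exact ⟨h1, max_le h2 hsM⟩
  obtain ⟨h1, h2⟩ := hstate (Nat.find hex - n) (by omega)
  rw [Nat.add_sub_cancel' hnk] at h1 h2
  have := hno _ hnk
  rw [burnTime_eq_some_iff.2 ⟨ht, h2.trans_lt hMt, h1.trans_lt hMt⟩] at this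
  simp at this

end Site

/-! ### Passing from a site to its right neighbour -/

section Neighbours

variable {w d : ℕ → ℕ → ℝ} {k l x y : ℕ} {t : ℝ}

lemma fireTime_succ_eq_some (h : fireTime w d (x + 1) k = some t) :
    ∃ s, fireTime w d x k = some s ∧ t = s + d x (burnsBefore (fireTime w d x) k) := by
  have := (burnTime_eq_some_iff.1 h).1
  simp only [spreadTime, Option.map_eq_some_iff] at this
  obtain ⟨s, hs, rfl⟩ := this
  exact ⟨s, hs, rfl⟩

lemma fireTime_succ_lt {s : ℝ} (hkl : k < l) (hk : fireTime w d (x + 1) k = some s)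
    (hl : fireTime w d (x + 1) l = some t) : s < t :=
  lt_of_burnTime hkl (burnTime_eq_some_iff.1 hk).1 hl

lemma Reaches.of_succ (h : Reaches w d k (x + 1)) : Reaches w d k x := by
  obtain ⟨t, ht⟩ := Option.isSome_iff_exists.1 h
  obtain ⟨s, hs, -⟩ := fireTime_succ_eq_some ht
  simp [Reaches, hs]

lemma Reaches.mono (h : Reaches w d k y) (hxy : x ≤ y) : Reaches w d k x := by
  induction y, hxy using Nat.le_induction with
  | base => exact h
  | succ y _ ih => exact ih h.of_succ

lemma rightmost_eq_top_iff : rightmost w d k = ⊤ ↔ ∀ x, Reaches w d k x := by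
  constructor
  · intro h x
    by_contra hx
    have : rightmost w d k ≤ x := iSup_le fun y => by
      have : (y : ℕ) ≤ x := by
        by_contra! hxy
        exact hx (y.2.mono hxy.le)
      exact_mod_cast this
    rw [h, top_le_iff] at this
    exact ENat.natCast_ne_top x this
  · intro h
    refine ENat.eq_top_iff_forall_ge.2 fun n => ?_
    exact le_iSup (fun x : {x : ℕ // Reaches w d k x} => ((x : ℕ) : ℕ∞)) ⟨n, h n⟩

lemma burnsBefore_fireTime_antitone :
    Antitone fun x => burnsBefore (fireTime w d x) k := by
  refine antitone_nat_of_succ_le fun x => card_le_card fun j hj => ?_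
  simp only [mem_filter] at hj ⊢
  exact ⟨hj.1, Reaches.of_succ hj.2⟩

/-- Far from the origin, the number of earlier fires which are still present is constant. -/
lemma exists_burnsBefore_eq (w d : ℕ → ℕ → ℝ) (k : ℕ) :
    ∃ i n, ∀ x ≥ n, burnsBefore (fireTime w d x) k = i := by
  obtain ⟨n, hn⟩ := WellFoundedGT.monotone_chain_condition
    (⟨fun x => OrderDual.toDual (burnsBefore (fireTime w d x) k),
      burnsBefore_fireTime_antitone⟩ : ℕ →o ℕᵒᵈ)
  exact ⟨_, n, fun x hx => (hn x hx).symm⟩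

lemma burnsBefore_lt_of_lt {f : ℕ → Option ℝ} (hkl : k < l) (hk : (f k).isSome) :
    burnsBefore f k < burnsBefore f l := by
  refine card_lt_card (ssubset_iff_of_subset ?_ |>.2 ⟨k, ?_, ?_⟩)
  · exact filter_subset_filter _ (by simpa using hkl.le)
  · simp [hkl, hk]
  · simp

lemma burnsBefore_eq_zero {f : ℕ → Option ℝ} (h : ∀ j < k, f j = none) : burnsBefore f k = 0 := by
  simpa [burnsBefore, filter_eq_empty_iff] using h

end Neighbours

/-! ### Consequences of typical waiting times and delays -/

/-- The properties of the waiting times `w` and of the delays `d` which hold almost surely and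
determine how many fires are infinite. -/
structure IsTypical (w d : ℕ → ℕ → ℝ) : Prop where
  waiting_nonneg : ∀ x i, 0 ≤ w x i
  delay_nonneg : ∀ x i, 0 ≤ d x i
  /-- infinitely many fires start, and they start at arbitrarily late times -/
  tendsto_waiting : Tendsto (fun n => ∑ j ∈ range n, w 0 j) atTop atTop
  /-- far from the origin, the first tree appears before any fire can arrive -/
  eventually_waiting_lt : ∀ᶠ x in atTop, w (x + 1) 0 < ∑ y ∈ range (x + 1), d y 0
  tendsto_delay : ∀ i, Tendsto (fun n => ∑ x ∈ range n, d x i) atTop atTop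
  not_bddBelow_delay_sub : ∀ i j, i ≠ j →
    ¬ BddBelow (Set.range fun n => ∑ x ∈ range n, (d x j - d x i))

namespace IsTypical

variable {w d : ℕ → ℕ → ℝ} (h : IsTypical w d) {k l x : ℕ} {t : ℝ}
include h

/-- Every site is burnt infinitely often, at times which tend to infinity. -/
lemma fireTime_frequently_and_tendsto (x : ℕ) :
    (∀ n, ∃ k ≥ n, Reaches w d k x) ∧
      ∀ M : ℝ, ∀ᶠ k in atTop, ∀ t ∈ fireTime w d x k, M < t := by
  induction x with
  | zero =>
    refine ⟨fun n => ⟨n, le_rfl, rfl⟩, fun M => ?_⟩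
    filter_upwards [((tendsto_add_atTop_iff_nat 1).2 h.tendsto_waiting).eventually_gt_atTop M]
      with k hk t ht
    simp only [fireTime, Option.mem_def, Option.some.injEq] at ht
    exact ht ▸ hk
  | succ x ih =>
    obtain ⟨hinf, hlim⟩ := ih
    constructor
    · refine exists_burnTime_ne_none fun M => frequently_atTop.2 fun n => ?_
      obtain ⟨m, hm⟩ := eventually_atTop.1 (hlim M)
      obtain ⟨k, hk, hr⟩ := hinf (max n m)
      obtain ⟨s, hs⟩ := Option.isSome_iff_exists.1 hr
      refine ⟨k, le_of_max_le_left hk, s + d x (burnsBefore (fireTime w d x) k), ?_, ?_⟩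
      · simp [spreadTime, hs]
      · linarith [hm k (le_of_max_le_right hk) s hs, h.delay_nonneg x
          (burnsBefore (fireTime w d x) k)]
    · intro M
      filter_upwards [hlim M] with k hk t ht
      obtain ⟨s, hs, rfl⟩ := fireTime_succ_eq_some ht
      linarith [hk s hs, h.delay_nonneg x (burnsBefore (fireTime w d x) k)]

lemma exists_first_reaches (x : ℕ) : ∃ k, Reaches w d k x ∧ ∀ j < k, ¬ Reaches w d j x := by
  classical
  have hex : ∃ k, Reaches w d k x := by
    obtain ⟨k, -, hk⟩ := (h.fireTime_frequently_and_tendsto x).1 0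
    exact ⟨k, hk⟩
  exact ⟨Nat.find hex, Nat.find_spec hex, fun j hj => Nat.find_min hex hj⟩

/-- No fire is faster than one which travels with the delays of the first burnings: it cannot
overtake the first fire which burns a site. -/
lemma sum_delay_le_fireTime (ht : fireTime w d x k = some t) :
    ∑ y ∈ range x, d y 0 ≤ t := by
  induction x generalizing k t with
  | zero =>
    simp only [fireTime, Option.some.injEq] at ht
    simpa [← ht] using sum_nonneg fun j _ => h.waiting_nonneg 0 j
  | succ x ih =>
    obtain ⟨m, hm, hfirst⟩ := h.exists_first_reaches x
    obtain ⟨s, hs⟩ := Option.isSome_iff_exists.1 hm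
    have h0 : burnsBefore (fireTime w d x) m = 0 :=
      burnsBefore_eq_zero fun j hj => by simpa [Reaches] using hfirst j hj
    have hspread : spreadTime (d x) (fireTime w d x) m = some (s + d x 0) := by
      simp [spreadTime, hs, h0]
    have hle : s + d x 0 ≤ t := by
      have hk : Reaches w d k x := Reaches.of_succ (by simp [Reaches, ht])
      rcases (not_lt.1 fun hlt => hfirst k hlt hk).eq_or_lt with rfl | hlt
      · have := (burnTime_eq_some_iff.1 ht).1
        rw [hspread, Option.some.injEq] at this
        exact this.le
      · exact (lt_of_burnTime hlt hspread ht).le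
    rw [sum_range_succ]
    linarith [ih hs]

/-- Some fire burns all sites, namely the first fire which burns a site beyond which the first tree
always appears before any fire can arrive. -/
lemma exists_forall_reaches : ∃ k, ∀ x, Reaches w d k x := by
  obtain ⟨n, hn⟩ := eventually_atTop.1 h.eventually_waiting_lt
  obtain ⟨k, hk, hfirst⟩ := h.exists_first_reaches n
  suffices H : ∀ x ≥ n, Reaches w d k x by
    exact ⟨k, fun x => (H (max x n) (le_max_right _ _)).mono (le_max_left _ _)⟩
  intro x hx
  induction x, hx using Nat.le_induction with
  | base => exact hk
  | succ x hx ih =>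
    have hnone : ∀ j < k, fireTime w d x j = none := fun j hj => by
      have : ¬ Reaches w d j x := fun hr => hfirst j hj (hr.mono hx)
      simpa [Reaches] using this
    obtain ⟨s, hs⟩ := Option.isSome_iff_exists.1 ih
    have hspread : spreadTime (d x) (fireTime w d x) k = some (s + d x 0) := by
      simp [spreadTime, hs, burnsBefore_eq_zero hnone]
    have hlt : w (x + 1) 0 < s + d x 0 := by
      have h1 := hn x hx
      rw [sum_range_succ] at h1
      linarith [h.sum_delay_le_fireTime hs]
    have : fireTime w d (x + 1) k = some (s + d x 0) := by
      refine burnTime_eq_some_iff.2 ⟨hspread, ?_⟩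
      rw [siteState_eq_zero fun j hj => by simp [spreadTime, hnone j hj]]
      exact ⟨(h.waiting_nonneg _ _).trans_lt hlt, hlt⟩
    simp [Reaches, this]

/-- The delay between two fires which burn all sites would be a positive process which, far from the
origin, has the increments `d x j - d x i` for some fixed `i ≠ j`. -/
lemma not_forall_reaches_of_lt (hkl : k < l) (hk : ∀ x, Reaches w d k x)
    (hl : ∀ x, Reaches w d l x) : False := by
  obtain ⟨i, m, hi⟩ := exists_burnsBefore_eq w d k
  obtain ⟨j, n, hj⟩ := exists_burnsBefore_eq w d l
  set N := max m n + 1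
  have hij : i ≠ j := by
    rw [← hi N (by omega), ← hj N (by omega)]
    exact (burnsBefore_lt_of_lt hkl (hk N)).ne
  choose s hs using fun x => Option.isSome_iff_exists.1 (hk x)
  choose t ht using fun x => Option.isSome_iff_exists.1 (hl x)
  have hstep : ∀ x ≥ N, t (x + 1) - s (x + 1) = t x - s x + (d x j - d x i) := by
    intro x hx
    obtain ⟨s', hs', hs1⟩ := fireTime_succ_eq_some (hs (x + 1))
    obtain ⟨t', ht', ht1⟩ := fireTime_succ_eq_some (ht (x + 1))
    rw [hs x, Option.some.injEq] at hs'
    rw [ht x, Option.some.injEq] at ht'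
    rw [hs1, ht1, hi x (by omega), hj x (by omega), hs', ht']
    ring
  have hdiff : ∀ x ≥ N, ∑ y ∈ range x, (d y j - d y i) =
      t x - s x - (t N - s N) + ∑ y ∈ range N, (d y j - d y i) := by
    intro x hx
    induction x, hx using Nat.le_induction with
    | base => ring
    | succ x hx ih => rw [sum_range_succ, ih, hstep x hx]; ring
  refine h.not_bddBelow_delay_sub i j hij ?_
  have hev : IsBoundedUnder (· ≥ ·) atTop fun n => ∑ y ∈ range n, (d y j - d y i) := by
    refine ⟨-(t N - s N) + ∑ y ∈ range N, (d y j - d y i), ?_⟩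
    rw [eventually_map]
    filter_upwards [eventually_ge_atTop N] with x hx
    obtain ⟨x, rfl⟩ : ∃ x', x = x' + 1 := ⟨x - 1, by omega⟩
    have hpos := fireTime_succ_lt hkl (hs (x + 1)) (ht (x + 1))
    rw [ge_iff_le, hdiff _ hx]
    linarith
  exact hev.bddBelow_range

lemma duration_eq_top (hk : ∀ x, Reaches w d k x) : duration w d k = ⊤ := by
  obtain ⟨i, n, hi⟩ := exists_burnsBefore_eq w d k
  have hlim : Tendsto (fun m => ∑ x ∈ range m, d x i - ∑ x ∈ range n, d x i) atTop atTop :=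
    tendsto_atTop_add_const_right _ _ (h.tendsto_delay i)
  rw [← top_le_iff]
  refine le_of_tendsto (ENNReal.tendsto_ofReal_atTop.comp hlim) ?_
  filter_upwards [eventually_ge_atTop n] with m hm
  rw [Function.comp_apply, ← sum_Ico_eq_sub _ hm,
    ENNReal.ofReal_sum_of_nonneg fun x _ => h.delay_nonneg x i]
  refine le_trans (sum_le_sum fun x hx => ?_) (ENNReal.sum_le_tsum (Ico n m))
  rw [if_pos (hk (x + 1)), hi x (mem_Ico.1 hx).1]

theorem existsUnique_infinite :
    (∃! k, IsInfiniteFire w d k) ∧ ∃! k, rightmost w d k = ⊤ := by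
  have huniq : ∀ k l, rightmost w d k = ⊤ → rightmost w d l = ⊤ → k = l := by
    intro k l hk hl
    rw [rightmost_eq_top_iff] at hk hl
    rcases lt_trichotomy k l with hlt | heq | hlt
    · exact (h.not_forall_reaches_of_lt hlt hk hl).elim
    · exact heq
    · exact (h.not_forall_reaches_of_lt hlt hl hk).elim
  obtain ⟨k, hk⟩ := h.exists_forall_reaches
  have htop := rightmost_eq_top_iff.2 hk
  exact ⟨⟨k, ⟨htop, h.duration_eq_top hk⟩, fun l hl => huniq l k hl.1 htop⟩,
    ⟨k, htop, fun l hl => huniq l k hl htop⟩⟩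

end IsTypical

end ForestFire

namespace ProbabilityTheory

open Filter

variable {Ω : Type*} [MeasurableSpace Ω] {P : Measure Ω}

/-! ### Independent sequences and symmetric random walks -/

/-- The rows of an array of independent random variables are independent as random sequences. -/
theorem iIndepFun.curry {ι κ β : Type*} [Countable ι] [Countable κ] [MeasurableSpace β]
    {f : ι → κ → Ω → β} (hf : ∀ i j, Measurable (f i j))
    (h : iIndepFun (fun p : ι × κ => f p.1 p.2) P) :
    iIndepFun (fun i ω j => f i j ω) P := by
  have := h.isProbabilityMeasure
  have (p : ι × κ) : IsProbabilityMeasure (P.map (f p.1 p.2)) :=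
    Measure.isProbabilityMeasure_map (hf _ _).aemeasurable
  have (i : ι) (j : κ) : IsProbabilityMeasure (P.map (f i j)) :=
    Measure.isProbabilityMeasure_map (hf _ _).aemeasurable
  rw [iIndepFun_iff_map_fun_eq_infinitePi_map fun i => measurable_pi_iff.2 (hf i)]
  have h1 := h.map_fun_eq_infinitePi_map fun (p : ι × κ) => hf p.1 p.2
  have h2 := fun i => (h.precomp (Prod.mk_right_injective i)).map_fun_eq_infinitePi_map
    fun j => hf i j
  have h3 := Measure.infinitePi_map_curry (fun i j => P.map (f i j))
  rw [← h1, Measure.map_map (by fun_prop) (measurable_pi_iff.2 fun p : ι × κ => hf p.1 p.2)] at h3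
  simp_rw [h2, ← h3]
  rfl


/-- The second Borel-Cantelli lemma for independent and identically distributed variables. -/
theorem iIndepFun.ae_frequently_mem {β : Type*} [MeasurableSpace β] {X : ℕ → Ω → β}
    (hX : ∀ n, Measurable (X n)) (h : iIndepFun X P) (hid : ∀ n, IdentDistrib (X n) (X 0) P P)
    {s : Set β} (hs : MeasurableSet s) (hpos : P (X 0 ⁻¹' s) ≠ 0) :
    ∀ᵐ ω ∂P, ∃ᶠ n in atTop, X n ω ∈ s := by
  have := h.isProbabilityMeasure
  have hmeas : ∀ n, MeasurableSet (X n ⁻¹' s) := fun n => hX n hs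
  have hind : iIndepSet (fun n => X n ⁻¹' s) P := by
    rw [iIndepSet_iff_meas_biInter hmeas]
    exact fun t => h.measure_inter_preimage_eq_mul t fun _ _ => hs
  have hsum : ∑' n, P (X n ⁻¹' s) = ⊤ := by
    simp_rw [fun n => (hid n).measure_mem_eq hs]
    exact ENNReal.tsum_const_eq_top_of_ne_zero hpos
  have h1 := measure_limsup_eq_one hmeas hind hsum
  rw [← prob_compl_eq_zero_iff (MeasurableSet.measurableSet_limsup hmeas)] at h1
  filter_upwards [compl_mem_ae_iff.2 h1] with ω hω
  rw [Set.mem_compl_iff, Set.notMem_compl_iff, mem_limsup_iff_frequently_mem] at hω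
  exact hω

/-- Whether a random walk is bounded below does not depend on its first steps, so that Kolmogorov's
0-1 law applies. -/
theorem iIndepFun.measure_bddBelow_sum_zero_or_one {X : ℕ → Ω → ℝ}
    (hX : ∀ n, Measurable (X n)) (h : iIndepFun X P) :
    P {ω | BddBelow (Set.range fun n => ∑ i ∈ Finset.range n, X i ω)} = 0 ∨
      P {ω | BddBelow (Set.range fun n => ∑ i ∈ Finset.range n, X i ω)} = 1 := by
  refine measure_zero_or_one_of_measurableSet_limsup_atTop (fun n => (hX n).comap_le)
    (iIndepFun_iff_iIndep _ _ _ |>.1 h) ?_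
  rw [limsup_eq_iInf_iSup_of_nat, MeasurableSpace.measurableSet_iInf]
  intro m
  have hshift : {ω | BddBelow (Set.range fun n => ∑ i ∈ Finset.range n, X i ω)} =
      {ω | BddBelow (Set.range fun n => ∑ i ∈ Finset.range n, X (m + i) ω)} := by
    ext ω
    have hsplit : ∀ n, ∑ i ∈ Finset.range (n + m), X i ω =
        ∑ i ∈ Finset.range m, X i ω + ∑ i ∈ Finset.range n, X (m + i) ω := fun n => by
      rw [add_comm n m, Finset.sum_range_add]
    constructor
    · rintro ⟨c, hc⟩
      refine ⟨c - ∑ i ∈ Finset.range m, X i ω, ?_⟩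
      rintro _ ⟨n, rfl⟩
      have := hc ⟨n + m, rfl⟩
      simp only [hsplit] at this
      simpa [add_comm] using this
    · rintro ⟨c, hc⟩
      have hev : IsBoundedUnder (· ≥ ·) atTop fun n => ∑ i ∈ Finset.range n, X i ω := by
        refine ⟨∑ i ∈ Finset.range m, X i ω + c, ?_⟩
        rw [eventually_map]
        filter_upwards [eventually_ge_atTop m] with n hn
        obtain ⟨n, rfl⟩ := Nat.exists_eq_add_of_le' hn
        rw [hsplit]
        exact add_le_add_right (hc ⟨n, rfl⟩) _
      exact hev.bddBelow_range
  rw [hshift]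
  refine measurableSet_bddBelow_range fun n => Finset.measurable_sum _ fun i _ => ?_
  exact Measurable.mono (comap_measurable (X (m + i)))
    (le_iSup₂_of_le (m + i) (Nat.le_add_right m i) le_rfl) le_rfl

/-- A random walk whose steps exceed some `ε > 0` with positive probability has arbitrarily large
increments: in one of infinitely many disjoint blocks of `N > M / ε` steps, all steps exceed `ε`. -/
theorem iIndepFun.ae_exists_lt_sum_sub {X : ℕ → Ω → ℝ}
    (hX : ∀ n, Measurable (X n)) (h : iIndepFun X P) (hid : ∀ n, IdentDistrib (X n) (X 0) P P)
    (hpos : P {ω | 0 < X 0 ω} ≠ 0) (M : ℝ) :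
    ∀ᵐ ω ∂P, ∃ m n, M < ∑ i ∈ Finset.range n, X i ω - ∑ i ∈ Finset.range m, X i ω := by
  obtain ⟨ε, hε, hεpos⟩ : ∃ ε > 0, P {ω | ε < X 0 ω} ≠ 0 := by
    have hunion : {ω | 0 < X 0 ω} = ⋃ n : ℕ, {ω | 1 / ((n : ℝ) + 1) < X 0 ω} := by
      ext ω
      simp only [Set.mem_ofPred_eq, Set.mem_iUnion]
      exact ⟨exists_nat_one_div_lt, fun ⟨n, hn⟩ => lt_trans (by positivity) hn⟩
    rw [hunion, Ne, measure_iUnion_null_iff, not_forall] at hpos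
    obtain ⟨n, hn⟩ := hpos
    exact ⟨_, by positivity, hn⟩
  obtain ⟨N, hN⟩ := exists_nat_gt (M / ε)
  rw [div_lt_iff₀ hε] at hN
  -- A negative `M` allows `N = 0`, and then the empty block will do.
  rcases N.eq_zero_or_pos with rfl | hNpos
  · exact ae_of_all _ fun ω => ⟨0, 0, by simpa using hN⟩
  have hinj : Function.Injective fun p : ℕ × Fin N => N * p.1 + p.2 := by
    rintro ⟨b, r⟩ ⟨b', r'⟩ hp
    have hdiv := congrArg (· / N) hp
    have hmod := congrArg (· % N) hp
    simp only [Nat.mul_add_div hNpos, Nat.mul_add_mod, Nat.div_eq_of_lt r.2, Nat.div_eq_of_lt r'.2,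
      Nat.mod_eq_of_lt r.2, Nat.mod_eq_of_lt r'.2] at hdiv hmod
    exact Prod.ext (by simpa using hdiv) (Fin.ext hmod)
  have hblock := h.precomp hinj
  have hZ : iIndepFun (fun (b : ℕ) ω (r : Fin N) => X (N * b + r) ω) P :=
    iIndepFun.curry (f := fun b (r : Fin N) => X (N * b + r)) (fun _ _ => hX _) hblock
  have hrow : ∀ b : ℕ, iIndepFun (fun r : Fin N => X (N * b + r)) P := fun b =>
    hblock.precomp (g := fun r => (b, r)) (Prod.mk_right_injective b)
  have hfreq := hZ.ae_frequently_mem (s := {z | ∀ r, ε < z r})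
    (fun b => measurable_pi_iff.2 fun r => hX _)
    (fun b => IdentDistrib.pi (fun r => (hid _).trans (hid _).symm) (hrow b) (hrow 0))
    (by
      rw [Set.ofPred_forall]
      exact MeasurableSet.iInter fun r => measurableSet_lt measurable_const (measurable_pi_apply r))
    (by
      have := (hrow 0).measure_inter_preimage_eq_mul Finset.univ (sets := fun _ => Set.Ioi ε)
        fun _ _ => measurableSet_Ioi
      have hset : (fun ω (r : Fin N) => X (N * 0 + r) ω) ⁻¹' {z | ∀ r, ε < z r} =
          ⋂ r ∈ (Finset.univ : Finset (Fin N)), X (N * 0 + r) ⁻¹' Set.Ioi ε := by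
        ext ω; simp
      rw [hset, this, Finset.prod_ne_zero_iff]
      intro r _
      rw [(hid _).measure_mem_eq measurableSet_Ioi]
      exact hεpos)
  filter_upwards [hfreq] with ω hω
  obtain ⟨b, hb⟩ := hω.exists
  refine ⟨N * b, N * b + N, hN.trans_le ?_⟩
  rw [Finset.sum_range_add, add_sub_cancel_left, ← Fin.sum_univ_eq_sum_range
    (fun i => X (N * b + i) ω), ← nsmul_eq_mul]
  simpa using Finset.card_nsmul_le_sum Finset.univ (fun r : Fin N => X (N * b + r) ω) ε
    fun r _ => (hb r).le

/-- A nondegenerate symmetric random walk is not bounded below, without any moment assumption. By the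
0-1 law it would otherwise be almost surely bounded below, and by symmetry also bounded above, while
it has arbitrarily large increments. -/
theorem iIndepFun.ae_not_bddBelow_sum {X : ℕ → Ω → ℝ}
    (hX : ∀ n, Measurable (X n)) (h : iIndepFun X P) (hid : ∀ n, IdentDistrib (X n) (X 0) P P)
    (hsymm : IdentDistrib (X 0) (fun ω => -X 0 ω) P P) (hpos : P {ω | 0 < X 0 ω} ≠ 0) :
    ∀ᵐ ω ∂P, ¬ BddBelow (Set.range fun n => ∑ i ∈ Finset.range n, X i ω) := by
  have := h.isProbabilityMeasure
  rcases h.measure_bddBelow_sum_zero_or_one hX with h0 | h1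
  · exact measure_eq_zero_iff_ae_notMem.1 h0
  exfalso
  have hneg : iIndepFun (fun n ω => -X n ω) P := h.comp (fun _ x => -x) fun _ => measurable_neg
  have hpi : IdentDistrib (fun ω n => X n ω) (fun ω n => -X n ω) P P := by
    refine IdentDistrib.pi (fun n => ?_) h hneg
    exact ((hid n).trans hsymm).trans ((hid n).comp measurable_neg).symm
  have hmeasB : MeasurableSet
      {z : ℕ → ℝ | BddBelow (Set.range fun n => ∑ i ∈ Finset.range n, z i)} :=
    measurableSet_bddBelow_range fun n => by fun_prop
  have h2 := hpi.measure_mem_eq hmeasB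
  have hae : ∀ (z : Ω → ℕ → ℝ), (∀ n, Measurable fun ω => z ω n) →
      P (z ⁻¹' {z | BddBelow (Set.range fun n => ∑ i ∈ Finset.range n, z i)}) = 1 →
      ∀ᵐ ω ∂P, BddBelow (Set.range fun n => ∑ i ∈ Finset.range n, z ω i) := fun z hz h1 =>
    (mem_ae_iff_prob_eq_one (measurable_pi_iff.2 hz hmeasB)).2 h1
  have hbelow := hae (fun ω n => X n ω) hX h1
  have habove := hae (fun ω n => -X n ω) (fun n => (hX n).neg) (h2 ▸ h1)
  have hM := ae_all_iff.2 fun M : ℕ => h.ae_exists_lt_sum_sub hX hid hpos M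
  obtain ⟨ω, ⟨c, hc⟩, ⟨c', hc'⟩, hω⟩ := (hbelow.and (habove.and hM)).exists
  obtain ⟨M, hMc⟩ := exists_nat_gt (-c' - c)
  obtain ⟨m, n, hmn⟩ := hω M
  have hm := hc ⟨m, rfl⟩
  have hn := hc' ⟨n, rfl⟩
  simp only [Finset.sum_neg_distrib] at hm hn
  linarith

end ProbabilityTheory

namespace ForestFire

open Filter

variable {Ω : Type*} [MeasurableSpace Ω] {P : Measure Ω}

/-! ### Exponential waiting times -/

lemma expMeasure_one_Ioi {t : ℝ} (ht : 0 ≤ t) :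
    expMeasure 1 (Set.Ioi t) = ENNReal.ofReal (Real.exp (-t)) := by
  have := isProbabilityMeasure_expMeasure one_pos
  rw [← Set.compl_Iic, prob_compl_eq_one_sub measurableSet_Iic, ← ofReal_cdf,
    cdf_expMeasure_eq one_pos, if_pos ht, ← ENNReal.ofReal_one,
    ← ENNReal.ofReal_sub _ (by simpa using ht)]
  simp

lemma ae_nonneg_of_hasLaw_exp {Y : Ω → ℝ} (h : HasLaw Y (expMeasure 1) P) :
    ∀ᵐ ω ∂P, 0 ≤ Y ω := by
  have := isProbabilityMeasure_expMeasure one_pos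
  rw [h.ae_iff (p := fun y => 0 ≤ y) (by fun_prop)]
  have h0 : expMeasure 1 (Set.Iic 0) = 0 := by
    rw [← ofReal_cdf, cdf_expMeasure_eq one_pos]; simp
  filter_upwards [measure_eq_zero_iff_ae_notMem.1 h0] with y hy
  exact (not_le.1 hy).le

lemma ae_tendsto_sum_of_hasLaw_exp {Y : ℕ → Ω → ℝ} (hY : ∀ n, Measurable (Y n))
    (hlaw : ∀ n, HasLaw (Y n) (expMeasure 1) P) (h : iIndepFun Y P) :
    ∀ᵐ ω ∂P, Tendsto (fun n => ∑ j ∈ Finset.range n, Y j ω) atTop atTop := by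
  have hfreq := h.ae_frequently_mem hY
    (fun n => ⟨(hY n).aemeasurable, (hY 0).aemeasurable, by rw [(hlaw n).map_eq, (hlaw 0).map_eq]⟩)
    (measurableSet_Ioi (a := (1 : ℝ))) (by
      rw [← Measure.map_apply (hY 0) measurableSet_Ioi, (hlaw 0).map_eq,
        expMeasure_one_Ioi zero_le_one]
      simp [Real.exp_pos])
  filter_upwards [hfreq, ae_all_iff.2 fun n => ae_nonneg_of_hasLaw_exp (hlaw n)] with ω hω hnn
  rw [← not_summable_iff_tendsto_nat_atTop_of_nonneg hnn]
  intro hs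
  obtain ⟨n, h1, h2⟩ :=
    (hω.and_eventually (hs.tendsto_atTop_zero.eventually_lt_const one_pos)).exists
  exact lt_asymm h1 h2

lemma ae_eventually_lt_mul_of_hasLaw_exp {Y : ℕ → Ω → ℝ} (hY : ∀ n, Measurable (Y n))
    (hlaw : ∀ n, HasLaw (Y n) (expMeasure 1) P) {c : ℝ} (hc : 0 < c) :
    ∀ᵐ ω ∂P, ∀ᶠ n : ℕ in atTop, Y n ω ≤ c * n := by
  have hsum : ∑' n : ℕ, P {ω | c * n < Y n ω} ≠ ⊤ := by
    have heq : ∀ n : ℕ, P {ω | c * n < Y n ω} = ENNReal.ofReal (Real.exp (-c) ^ n) := fun n => by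
      rw [← Real.exp_nat_mul, show (n : ℝ) * -c = -(c * n) by ring,
        ← expMeasure_one_Ioi (by positivity), ← (hlaw n).map_eq,
        Measure.map_apply (hY n) measurableSet_Ioi]
      rfl
    simp_rw [heq]
    exact (summable_geometric_of_lt_one (Real.exp_pos _).le
      (by simpa using hc)).tsum_ofReal_ne_top
  filter_upwards [ae_eventually_notMem hsum] with ω hω
  filter_upwards [hω] with n hn
  exact not_lt.1 hn

/-! ### Delays -/

/-- By the strong law of large numbers, the half mean being any rate below the mean. -/
lemma ae_eventually_half_mean_lt_sum {ν : Measure ℝ} (hint : Integrable (fun s : ℝ => s) ν)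
    (hmean : 0 < ∫ s, s ∂ν) {Y : ℕ → Ω → ℝ} (hlaw : ∀ n, HasLaw (Y n) ν P) (h : iIndepFun Y P) :
    ∀ᵐ ω ∂P, ∀ᶠ n : ℕ in atTop, (∫ s, s ∂ν) / 2 * n < ∑ x ∈ Finset.range n, Y x ω := by
  have hlaw' : ∀ n, P.map (Y n) = ν := fun n => (hlaw n).map_eq
  have hint0 : Integrable (Y 0) P := by
    have : Integrable (fun s : ℝ => s) (P.map (Y 0)) := by rwa [hlaw']
    exact this.comp_aemeasurable (hlaw 0).aemeasurable
  have hslln := strong_law_ae_real Y hint0 (fun i j hij => h.indepFun hij)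
    fun n => ⟨(hlaw n).aemeasurable, (hlaw 0).aemeasurable, by rw [hlaw', hlaw']⟩
  filter_upwards [hslln] with ω hω
  rw [(hlaw 0).integral_eq] at hω
  filter_upwards [hω.eventually_const_lt (half_lt_self hmean), eventually_gt_atTop 0] with n hn hn0
  exact (lt_div_iff₀ (by exact_mod_cast hn0)).1 hn

/-- A law with positive variance gives mass to both sides of its mean. -/
lemma measure_Iio_mean_ne_zero_and {ν : Measure ℝ} [IsProbabilityMeasure ν]
    (hint : Integrable (fun s : ℝ => s) ν)
    (hvar : 0 < evariance (fun s : ℝ => s) ν) :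
    ν (Set.Iio (∫ s, s ∂ν)) ≠ 0 ∧ ν (Set.Ioi (∫ s, s ∂ν)) ≠ 0 := by
  have hconst : ¬ (fun s : ℝ => s) =ᵐ[ν] fun _ => ∫ s, s ∂ν := fun h =>
    hvar.ne' ((evariance_eq_zero_iff hint.aemeasurable).2 h)
  constructor <;> intro h0 <;> apply hconst
  · have hnn : 0 ≤ᵐ[ν] fun s => s - ∫ s, s ∂ν := by
      filter_upwards [measure_eq_zero_iff_ae_notMem.1 h0] with s hs
      simpa using hs
    have := (integral_eq_zero_iff_of_nonneg_ae hnn (hint.sub (integrable_const _))).1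
      (by rw [integral_sub hint (integrable_const _)]; simp)
    filter_upwards [this] with s hs
    exact sub_eq_zero.1 hs
  · have hnn : 0 ≤ᵐ[ν] fun s => (∫ s, s ∂ν) - s := by
      filter_upwards [measure_eq_zero_iff_ae_notMem.1 h0] with s hs
      simpa using hs
    have := (integral_eq_zero_iff_of_nonneg_ae hnn ((integrable_const _).sub hint)).1
      (by rw [integral_sub (integrable_const _) hint]; simp)
    filter_upwards [this] with s hs
    exact (sub_eq_zero.1 hs).symm

/-- The steps `D x j - D x i` form a symmetric random walk, and they are not almost surely zero since
`D x j` and `D x i` can lie on different sides of the mean. -/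
lemma ae_not_bddBelow_sum_sub {ν : Measure ℝ} [IsProbabilityMeasure ν]
    (hint : Integrable (fun s : ℝ => s) ν)
    (hvar : 0 < evariance (fun s : ℝ => s) ν) {D : ℕ → ℕ → Ω → ℝ} (hD : ∀ x i, Measurable (D x i))
    (hlaw : ∀ x i, HasLaw (D x i) ν P) (h : iIndepFun (fun p : ℕ × ℕ => D p.1 p.2) P)
    {i j : ℕ} (hij : i ≠ j) :
    ∀ᵐ ω ∂P, ¬ BddBelow (Set.range fun n => ∑ x ∈ Finset.range n, (D x j ω - D x i ω)) := by
  have := h.isProbabilityMeasure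
  have hX : ∀ x, Measurable fun ω => D x j ω - D x i ω := fun x => (hD x j).sub (hD x i)
  have hind : iIndepFun (fun x ω => D x j ω - D x i ω) P :=
    (iIndepFun.curry hD h).comp (fun _ z => z j - z i) fun _ => by fun_prop
  have hpair : ∀ x {i j : ℕ}, i ≠ j → IndepFun (D x j) (D x i) P := fun x i j hij =>
    h.indepFun (i := (x, j)) (j := (x, i)) (by simpa using hij.symm)
  have hpairlaw : ∀ x {i j : ℕ}, i ≠ j → P.map (fun ω => (D x j ω, D x i ω)) = ν.prod ν :=
    fun x i j hij => by
      rw [(hpair x hij).map_prod_eq_prod_map_map (hD x j).aemeasurable (hD x i).aemeasurable,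
        (hlaw x j).map_eq, (hlaw x i).map_eq]
  -- With different indices on the two sides, this is the symmetry of the steps.
  have hident : ∀ x y {i j i' j' : ℕ}, i ≠ j → i' ≠ j' →
      IdentDistrib (fun ω => D x j ω - D x i ω) (fun ω => D y j' ω - D y i' ω) P P :=
    fun x y i j i' j' hij hij' => by
      have : IdentDistrib (fun ω => (D x j ω, D x i ω)) (fun ω => (D y j' ω, D y i' ω)) P P :=
        ⟨((hD x j).prodMk (hD x i)).aemeasurable, ((hD y j').prodMk (hD y i')).aemeasurable,
          by rw [hpairlaw x hij, hpairlaw y hij']⟩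
      exact this.comp measurable_sub
  refine hind.ae_not_bddBelow_sum hX (fun n => hident n 0 hij hij) ?_ ?_
  · simpa only [neg_sub] using hident 0 0 hij hij.symm
  · obtain ⟨hlt, hgt⟩ := measure_Iio_mean_ne_zero_and hint hvar
    have hprod : P (D 0 j ⁻¹' Set.Ioi (∫ s, s ∂ν) ∩ D 0 i ⁻¹' Set.Iio (∫ s, s ∂ν)) ≠ 0 := by
      rw [(hpair 0 hij).measure_inter_preimage_eq_mul _ _ measurableSet_Ioi measurableSet_Iio,
        ← Measure.map_apply (hD 0 j) measurableSet_Ioi,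
        ← Measure.map_apply (hD 0 i) measurableSet_Iio, (hlaw 0 j).map_eq, (hlaw 0 i).map_eq]
      exact mul_ne_zero hgt hlt
    refine fun h0 => hprod (measure_mono_null (fun ω hω => ?_) h0)
    have h1 : ∫ s, s ∂ν < D 0 j ω := hω.1
    have h2 : D 0 i ω < ∫ s, s ∂ν := hω.2
    exact sub_pos.2 (h2.trans h1)

/-! ### Almost every realisation is typical -/

theorem ae_isTypical {ν : Measure ℝ} [IsProbabilityMeasure ν]
    (hnonneg : ∀ᵐ s ∂ν, 0 ≤ s) (hint : Integrable (fun s : ℝ => s) ν)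
    (hmean : 0 < ∫ s, s ∂ν) (hvar : 0 < evariance (fun s : ℝ => s) ν)
    {W D : ℕ → ℕ → Ω → ℝ} (hWm : ∀ x i, Measurable (W x i)) (hDm : ∀ x i, Measurable (D x i))
    (hW : ∀ x i, HasLaw (W x i) (expMeasure 1) P) (hD : ∀ x i, HasLaw (D x i) ν P)
    (hindep : iIndepFun
      (Sum.elim (fun p : ℕ × ℕ => W p.1 p.2) (fun p : ℕ × ℕ => D p.1 p.2)) P) :
    ∀ᵐ ω ∂P, IsTypical (fun x i => W x i ω) (fun x i => D x i ω) := by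
  have hWi : iIndepFun (fun p : ℕ × ℕ => W p.1 p.2) P := hindep.precomp Sum.inl_injective
  have hDi : iIndepFun (fun p : ℕ × ℕ => D p.1 p.2) P := hindep.precomp Sum.inr_injective
  have h1 : ∀ᵐ ω ∂P, ∀ x i, 0 ≤ W x i ω :=
    ae_all_iff.2 fun x => ae_all_iff.2 fun i => ae_nonneg_of_hasLaw_exp (hW x i)
  have h2 : ∀ᵐ ω ∂P, ∀ x i, 0 ≤ D x i ω := ae_all_iff.2 fun x => ae_all_iff.2 fun i =>
    ((hD x i).ae_iff (p := fun s => 0 ≤ s) (by fun_prop)).2 hnonneg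
  have h3 := ae_tendsto_sum_of_hasLaw_exp (hWm 0) (hW 0) 
    (hWi.precomp (g := fun i => (0, i)) (Prod.mk_right_injective 0))
  have h4 := ae_eventually_lt_mul_of_hasLaw_exp (fun x => hWm x 0) (fun x => hW x 0)
    (half_pos hmean)
  have h5 : ∀ᵐ ω ∂P, ∀ i, ∀ᶠ n : ℕ in atTop,
      (∫ s, s ∂ν) / 2 * n < ∑ x ∈ Finset.range n, D x i ω := ae_all_iff.2 fun i =>
    ae_eventually_half_mean_lt_sum hint hmean (fun x => hD x i)
      (hDi.precomp (g := fun x => (x, i)) (Prod.mk_left_injective i))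
  have h6 : ∀ᵐ ω ∂P, ∀ i j, i ≠ j →
      ¬ BddBelow (Set.range fun n => ∑ x ∈ Finset.range n, (D x j ω - D x i ω)) := by
    simp_rw [ae_all_iff]
    exact fun i j hij => ae_not_bddBelow_sum_sub hint hvar hDm hD hDi hij
  filter_upwards [h1, h2, h3, h4, h5, h6] with ω h1 h2 h3 h4 h5 h6
  refine ⟨h1, h2, h3, ?_, fun i => ?_, h6⟩
  · filter_upwards [(tendsto_add_atTop_nat 1).eventually (h4.and (h5 0))] with x hx
    exact hx.1.trans_lt hx.2
  · exact tendsto_atTop_mono' _ ((h5 i).mono fun n hn => hn.le)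
      (tendsto_natCast_atTop_atTop.const_mul_atTop (half_pos hmean))

end ForestFire

theorem mainTheorem2 {Ω : Type*} [MeasurableSpace Ω] (P : Measure Ω) [IsProbabilityMeasure P]
    (lawΔ : Measure ℝ) [IsProbabilityMeasure lawΔ]
    (hΔ_nonneg : ∀ᵐ s ∂lawΔ, 0 ≤ s)
    (hΔ_int : Integrable (fun s : ℝ => s) lawΔ)
    (hΔ_mean : 0 < ∫ s, s ∂lawΔ)
    (hΔ_var : 0 < evariance (fun s : ℝ => s) lawΔ)
    (W D : ℕ → ℕ → Ω → ℝ)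
    (hW : ∀ x i, HasLaw (W x i) (expMeasure 1) P)
    (hD : ∀ x i, HasLaw (D x i) lawΔ P)
    (hindep : iIndepFun
      (Sum.elim (fun p : ℕ × ℕ => W p.1 p.2) (fun p : ℕ × ℕ => D p.1 p.2)) P) :
    ∀ᵐ ω ∂P,
      (∃! k : ℕ, ForestFire.IsInfiniteFire (fun x i => W x i ω) (fun x i => D x i ω) k) ∧
      (∃! k : ℕ, ForestFire.rightmost (fun x i => W x i ω) (fun x i => D x i ω) k = ⊤) := by
  -- The variables are only almost everywhere measurable: pass to measurable versions.
  choose W' hWm hWW' using fun x i => (hW x i).aemeasurable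
  choose D' hDm hDD' using fun x i => (hD x i).aemeasurable
  have htyp := ForestFire.ae_isTypical hΔ_nonneg hΔ_int hΔ_mean hΔ_var hWm hDm
    (fun x i => (hW x i).congr (hWW' x i).symm) (fun x i => (hD x i).congr (hDD' x i).symm)
    (hindep.congr (by
      rintro (p | p)
      · exact hWW' p.1 p.2
      · exact hDD' p.1 p.2))
  have hWae : ∀ᵐ ω ∂P, ∀ x i, W x i ω = W' x i ω :=
    ae_all_iff.2 fun x => ae_all_iff.2 fun i => hWW' x i
  have hDae : ∀ᵐ ω ∂P, ∀ x i, D x i ω = D' x i ω :=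
    ae_all_iff.2 fun x => ae_all_iff.2 fun i => hDD' x i
  filter_upwards [htyp, hWae, hDae] with ω h hw hd
  simp_rw [hw, hd]
  exact h.existsUnique_infinite
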